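/- Let $k,n\ge 1$ be integers. Let $s(n,k)$ denote the (signed) Stirling numbers of the first kind, given by $\frac{[\ln(1+x)]^k}{k!}=\sum_{n\ge k}s(n,k)\frac{x^n}{n!}$ for $|x|<1$, and for integers $k\ge1$, $m\ge2$ put $$Q(k,m)=\sum_{\ell=0}^{m}\binom{k+\ell-1}{k-1}\,s(k+m-1,k+\ell-1)\left(\frac{k+m-2}{2}\right)^{\ell}.$$ For $-1\le x\le 1$ let $\operatorname{arccosh}x$ denote the principal value $\operatorname{arccosh}x=\ln\bigl(x+\sqrt{x+1}\,\sqrt{x-1}\bigr)\in\mathbb{C}$. For a function $f$ on $[-1,1]$, $f^{(n)}(x)\big|_{x=1^-}=c$ means that $f$ is $n$ times continuously differentiable (one-sidedly at $1$) on some interval $(1-\varepsilon,1]$, that its $n$-th left-hand derivative at $1$ is $c$, and that $f^{(n)}(x)\to c$ as $x\to1^-$. Then $$\bigl[(\arccos x)^{2k}\bigr]^{(n)}\Big|_{x=1^-}=\begin{cases}0,& n<k;\\ (-1)^k(2k)!!,& n=k;\\ (-1)^k\dfrac{(2k)!}{(2n-1)!!}\,Q(2k,2n-2k),& n>k,\end{cases}$$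 and $$\bigl[(\operatorname{arccosh} x)^{2k}\bigr]^{(n)}\Big|_{x=1^-}=\begin{cases}0,& n<k;\\ (2k)!!,& n=k;\\ \dfrac{(2k)!}{(2n-1)!!}\,Q(2k,2n-2k),& n>k.\end{cases}$$ -/

import Mathlib

open Set Filter Topology
open scoped Nat

/-- The signed Stirling numbers of the first kind `s(n, k)`, i.e. the numbers with
`(log (1 + x)) ^ k / k! = ∑_{n ≥ k} s(n, k) x ^ n / n!`; they are `(-1) ^ (n - k)` times the number
of permutations of `n` elements with `k` cycles, and vanish for `k > n`. -/
def signedStirlingFirst (n k : ℕ) : ℤ :=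
  (-1) ^ (n - k) * (Nat.stirlingFirst n k : ℤ)

/-- `Q(k, m) = ∑_{ℓ = 0}^{m} C(k + ℓ - 1, k - 1) s(k + m - 1, k + ℓ - 1) ((k + m - 2) / 2) ^ ℓ`,
meant for `k ≥ 1` and `m ≥ 2` (so that no subtraction of natural numbers is truncated). -/
noncomputable def stirlingQ (k m : ℕ) : ℝ :=
  ∑ ℓ ∈ Finset.range (m + 1),
    (Nat.choose (k + ℓ - 1) (k - 1) : ℝ) * (signedStirlingFirst (k + m - 1) (k + ℓ - 1) : ℝ)
      * (((k : ℝ) + (m : ℝ) - 2) / 2) ^ ℓ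

/-- The principal branch of the inverse hyperbolic cosine,
`arccosh z = log (z + √(z + 1) √(z - 1))`, with principal logarithm and square roots. -/
noncomputable def complexArccosh (z : ℂ) : ℂ :=
  Complex.log (z + (z + 1) ^ (1 / 2 : ℂ) * (z - 1) ^ (1 / 2 : ℂ))

/-- `f ^ (n)` at `a⁻` exists and equals `c`: on the closed left side of `a` the function `f` is
`n` times continuously differentiable near `a`, the `n`-th one-sided derivative at `a` is `c`, and
`c` is also the limit of the ordinary `n`-th derivative of `f` at `x` as `x → a⁻`. -/
structure HasLeftIteratedDeriv {F : Type*} [NormedAddCommGroup F] [NormedSpace ℝ F]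
    (n : ℕ) (f : ℝ → F) (c : F) (a : ℝ) : Prop where
  contDiffWithinAt : ContDiffWithinAt ℝ n f (Iic a) a
  iteratedDerivWithin_eq : iteratedDerivWithin n f (Iic a) a = c
  tendsto_iteratedDeriv : Tendsto (iteratedDeriv n f) (𝓝[<] a) (𝓝 c)

/-!
The function `cos √s` is entire with nonzero derivative at `s = 0`, so its local inverse `g` extends
`(arccos x) ^ 2` analytically through the branch point `x = 1`. Squaring `arccos' = -1 / √(1 - x²)`
gives `(1 - x²) g'² = 4 g`, so the Chebyshev operator `(1 - x²) d²/dx² - x d/dx`, which is `d²/dθ²`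
for `x = cos θ`, maps `g ^ (k + 1)` to `(2k + 2) (2k + 1) g ^ k`. Differentiating this `n` times at
`x = 1` expresses the derivative of order `n + 1` of `g ^ (k + 1)` through those of order `n`; after
division by `(-1) ^ k (2k)! / (2n - 1)‼` this is the recursion of the coefficients of
`∏_{j < n} (X - j ^ 2)`. Shifting the falling factorial of degree `2n - 1` by its midpoint `n - 1`
also gives this product, in the variable `X ^ 2` and divided by `X`, and expanding the shift
identifies its coefficients as `Q(2k, 2n - 2k)`. Finally `arccosh x = i arccos x` on `[-1, 1]`.
-/

open Polynomial

section CentralFactorial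

variable (R : Type*) [CommRing R]

theorem coeff_descPochhammer (n k : ℕ) :
    (descPochhammer R n).coeff k = signedStirlingFirst n k := by
  induction n generalizing k with
  | zero => cases k <;> simp [signedStirlingFirst, coeff_one]
  | succ n ih =>
    rw [descPochhammer_succ_right, mul_sub, coeff_sub, ← C_eq_natCast, coeff_mul_C]
    cases k with
    | zero =>
      rw [coeff_mul_X_zero, ih]
      cases n <;> simp [signedStirlingFirst]
    | succ k =>
      rw [coeff_mul_X, ih, ih]
      simp only [signedStirlingFirst, Nat.stirlingFirst_succ_succ, Nat.add_sub_add_right]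
      rcases lt_or_ge n (k + 1) with h | h
      · simp [Nat.stirlingFirst_eq_zero_of_lt h]
      · obtain ⟨d, rfl⟩ := Nat.exists_eq_add_of_le h
        rw [show k + 1 + d - k = d + 1 by lia, Nat.add_sub_cancel_left]
        push_cast
        ring

theorem descPochhammer_eq_prod_range (n : ℕ) :
    descPochhammer R n = ∏ i ∈ Finset.range n, (X - (i : R[X])) := by
  induction n with
  | zero => simp
  | succ n ih => rw [descPochhammer_succ_right, Finset.prod_range_succ, ih]

theorem taylor_natCast_descPochhammer (m n : ℕ) :
    taylor (m : R) (descPochhammer R n) = ∏ i ∈ Finset.range n, (X + (m : R[X]) - (i : R[X])) := by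
  rw [descPochhammer_eq_prod_range, taylor_apply, prod_comp]
  simp

/-- The polynomial `∏_{j < n} (X - j ^ 2)`, whose coefficients are the (signed) central factorial
numbers with even indices. -/
noncomputable def centralFactorialPoly (n : ℕ) : R[X] :=
  ∏ j ∈ Finset.range n, (X - C ((j : R) ^ 2))

theorem centralFactorialPoly_zero : centralFactorialPoly R 0 = 1 :=
  Finset.prod_range_zero _

theorem centralFactorialPoly_succ (n : ℕ) :
    centralFactorialPoly R (n + 1) = centralFactorialPoly R n * (X - C ((n : R) ^ 2)) :=
  Finset.prod_range_succ _ _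

theorem coeff_zero_centralFactorialPoly_succ (n : ℕ) :
    (centralFactorialPoly R (n + 1)).coeff 0 = 0 := by
  rw [centralFactorialPoly, Finset.prod_range_succ']
  simp [mul_coeff_zero]

theorem coeff_succ_centralFactorialPoly_succ (n k : ℕ) :
    (centralFactorialPoly R (n + 1)).coeff (k + 1) =
      (centralFactorialPoly R n).coeff k - n ^ 2 * (centralFactorialPoly R n).coeff (k + 1) := by
  rw [centralFactorialPoly_succ, mul_sub, coeff_sub, coeff_mul_X, coeff_mul_C, mul_comm]

theorem monic_centralFactorialPoly (n : ℕ) : (centralFactorialPoly R n).Monic :=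
  monic_prod_of_monic _ _ fun _ _ => monic_X_sub_C _

theorem natDegree_centralFactorialPoly [Nontrivial R] (n : ℕ) :
    (centralFactorialPoly R n).natDegree = n := by
  rw [centralFactorialPoly, natDegree_prod_of_monic _ _ fun _ _ => monic_X_sub_C _]
  simp only [natDegree_X_sub_C, Finset.sum_const, Finset.card_range, smul_eq_mul, mul_one]

theorem X_mul_taylor_descPochhammer (m : ℕ) :
    X * taylor (m : R) (descPochhammer R (2 * m + 1)) =
      expand R 2 (centralFactorialPoly R (m + 1)) := by
  induction m with
  | zero => simp [centralFactorialPoly, sq]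
  | succ m ih =>
    have shift : ∀ i ∈ Finset.range (2 * m + 1),
        (X + ((m + 1 : ℕ) : R[X]) - ((i + 1 : ℕ) : R[X])) = X + (m : R[X]) - (i : R[X]) := by
      intro i _
      push_cast
      ring
    rw [centralFactorialPoly_succ, map_mul, ← ih, taylor_natCast_descPochhammer,
      taylor_natCast_descPochhammer, show 2 * (m + 1) + 1 = 2 * m + 1 + 1 + 1 by ring,
      Finset.prod_range_succ, Finset.prod_range_succ', Finset.prod_congr rfl shift]
    simp only [map_sub, map_pow, map_natCast, expand_X]
    push_cast
    ring

theorem stirlingQ_succ_eq_coeff_taylor (j m : ℕ) :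
    stirlingQ (j + 1) m =
      (taylor (((j : ℝ) + m - 1) / 2) (descPochhammer ℝ (j + m))).coeff j := by
  have degree_lt : (hasseDeriv j (descPochhammer ℝ (j + m))).natDegree < m + 1 := by
    refine (natDegree_hasseDeriv_le _ _).trans_lt ?_
    rw [descPochhammer_natDegree]
    lia
  rw [taylor_coeff, eval_eq_sum_range' degree_lt, stirlingQ]
  refine Finset.sum_congr rfl fun l _ => ?_
  rw [hasseDeriv_coeff, coeff_descPochhammer, show j + 1 + l - 1 = l + j by lia,
    show j + 1 - 1 = j by lia, show j + 1 + m - 1 = j + m by lia]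
  push_cast
  ring

theorem stirlingQ_two_mul_eq_coeff_centralFactorialPoly {k n : ℕ} (hk : 1 ≤ k) (hkn : k ≤ n) :
    stirlingQ (2 * k) (2 * n - 2 * k) = (centralFactorialPoly ℝ n).coeff k := by
  obtain ⟨k, rfl⟩ := Nat.exists_eq_add_of_le' hk
  obtain ⟨d, rfl⟩ := Nat.exists_eq_add_of_le hkn
  have midpoint : (((2 * k + 1 : ℕ) : ℝ) + (2 * d : ℕ) - 1) / 2 = (k + d : ℕ) := by
    push_cast
    ring
  calc stirlingQ (2 * (k + 1)) (2 * (k + 1 + d) - 2 * (k + 1))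
      = stirlingQ (2 * k + 1 + 1) (2 * d) := by congr 1; lia
    _ = (taylor ((k + d : ℕ) : ℝ) (descPochhammer ℝ (2 * (k + d) + 1))).coeff (2 * k + 1) := by
      rw [stirlingQ_succ_eq_coeff_taylor, midpoint,
        show 2 * k + 1 + 2 * d = 2 * (k + d) + 1 by ring]
    _ = (expand ℝ 2 (centralFactorialPoly ℝ (k + d + 1))).coeff ((k + 1) * 2) := by
      rw [← X_mul_taylor_descPochhammer, show (k + 1) * 2 = 2 * k + 1 + 1 by ring, coeff_X_mul]
    _ = (centralFactorialPoly ℝ (k + 1 + d)).coeff (k + 1) := by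
      rw [coeff_expand_mul two_pos, add_right_comm]

theorem factorial_two_mul_div_doubleFactorial (k : ℕ) :
    ((2 * k)! : ℝ) / ((2 * k - 1)‼ : ℝ) = ((2 * k)‼ : ℝ) := by
  rw [div_eq_iff (mod_cast (Nat.doubleFactorial_pos _).ne')]
  cases k with
  | zero => simp
  | succ k => exact_mod_cast Nat.factorial_eq_mul_doubleFactorial (2 * k + 1)

theorem factorial_div_mul_coeff_centralFactorialPoly {k : ℕ} (hk : 1 ≤ k) (n : ℕ) :
    ((2 * k)! : ℝ) / ((2 * n - 1)‼ : ℝ) * (centralFactorialPoly ℝ n).coeff k =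
      if n < k then 0
      else if n = k then ((2 * k)‼ : ℝ)
      else ((2 * k)! : ℝ) / ((2 * n - 1)‼ : ℝ) * stirlingQ (2 * k) (2 * n - 2 * k) := by
  split_ifs with hlt heq
  · rw [coeff_eq_zero_of_natDegree_lt (by rwa [natDegree_centralFactorialPoly]), mul_zero]
  · have leading := (monic_centralFactorialPoly ℝ n).coeff_natDegree
    rw [natDegree_centralFactorialPoly] at leading
    rw [← heq, leading, mul_one, factorial_two_mul_div_doubleFactorial]
  · rw [stirlingQ_two_mul_eq_coeff_centralFactorialPoly hk (not_lt.1 hlt)]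

end CentralFactorial

section ChebyshevOperator

variable {𝕜 : Type*} [NontriviallyNormedField 𝕜]

/-- The Chebyshev differential operator `(1 - x²) y'' - x y'`, which is `d²/dθ²` in the coordinate
`x = cos θ`. -/
noncomputable def chebyshevOp (y : 𝕜 → 𝕜) (x : 𝕜) : 𝕜 :=
  (1 - x ^ 2) * deriv (deriv y) x - x * deriv y x

theorem hasDerivAt_one_sub_sq (x : 𝕜) : HasDerivAt (fun t : 𝕜 => 1 - t ^ 2) (-(2 * x)) x := by
  simpa using ((hasDerivAt_id x).pow 2).const_sub 1

variable [CompleteSpace 𝕜]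

theorem hasDerivAt_iteratedDeriv_of_analyticAt {y : 𝕜 → 𝕜} {x : 𝕜} (hy : AnalyticAt 𝕜 y x)
    (n : ℕ) : HasDerivAt (iteratedDeriv n y) (iteratedDeriv (n + 1) y x) x := by
  rw [iteratedDeriv_succ, iteratedDeriv_eq_iterate]
  exact (hy.iterated_deriv n).differentiableAt.hasDerivAt

theorem iteratedDeriv_chebyshevOp {y : 𝕜 → 𝕜} {x : 𝕜} (hy : AnalyticAt 𝕜 y x) (n : ℕ) :
    iteratedDeriv n (chebyshevOp y) x = (1 - x ^ 2) * iteratedDeriv (n + 2) y x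
      - (2 * n + 1) * x * iteratedDeriv (n + 1) y x - n ^ 2 * iteratedDeriv n y x := by
  induction n generalizing x with
  | zero => simp [chebyshevOp, iteratedDeriv_succ, iteratedDeriv_zero]
  | succ n ih =>
    have ih_near : iteratedDeriv n (chebyshevOp y) =ᶠ[𝓝 x] fun t =>
        (1 - t ^ 2) * iteratedDeriv (n + 2) y t
          - (2 * n + 1) * t * iteratedDeriv (n + 1) y t - n ^ 2 * iteratedDeriv n y t :=
      hy.eventually_analyticAt.mono fun t ht => ih ht
    have hlin : HasDerivAt (fun t : 𝕜 => (2 * (n : 𝕜) + 1) * t) (2 * n + 1) x := by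
      simpa using (hasDerivAt_id x).const_mul (2 * (n : 𝕜) + 1)
    have hderiv := hasDerivAt_iteratedDeriv_of_analyticAt hy
    rw [iteratedDeriv_succ, ih_near.deriv_eq,
      ((((hasDerivAt_one_sub_sq x).fun_mul (hderiv (n + 2))).fun_sub
        (hlin.fun_mul (hderiv (n + 1)))).fun_sub
        ((hderiv n).const_mul ((n : 𝕜) ^ 2))).deriv]
    push_cast
    ring

theorem iteratedDeriv_succ_one_of_chebyshevOp {y : 𝕜 → 𝕜} (hy : AnalyticAt 𝕜 y 1) (n : ℕ) :
    (2 * n + 1) * iteratedDeriv (n + 1) y 1 =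
      -(n ^ 2 * iteratedDeriv n y 1 + iteratedDeriv n (chebyshevOp y) 1) := by
  rw [iteratedDeriv_chebyshevOp hy]
  ring

section EikonalEquation

variable {g : 𝕜 → 𝕜} {a : 𝕜}

theorem chebyshevOp_eq_two [CharZero 𝕜] (hg : AnalyticAt 𝕜 g a) (hg' : deriv g a ≠ 0)
    (hode : ∀ᶠ x in 𝓝 a, (1 - x ^ 2) * deriv g x ^ 2 = 4 * g x) :
    ∀ᶠ x in 𝓝 a, chebyshevOp g x = 2 := by
  filter_upwards [EventuallyEq.deriv hode, hg.eventually_analyticAt,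
    hg.deriv.continuousAt.eventually_ne hg'] with x hx hgx hne
  rw [((hasDerivAt_one_sub_sq x).fun_mul (hgx.deriv.differentiableAt.hasDerivAt.fun_pow 2)).deriv,
    (hgx.differentiableAt.hasDerivAt.const_mul 4).deriv] at hx
  refine mul_left_cancel₀ (mul_ne_zero two_ne_zero hne) ?_
  rw [chebyshevOp]
  linear_combination hx

theorem deriv_deriv_pow_succ (hg : AnalyticAt 𝕜 g a) (k : ℕ) :
    deriv (deriv fun x => g x ^ (k + 1)) a =
      (k + 1) * (k * g a ^ (k - 1) * deriv g a ^ 2 + g a ^ k * deriv (deriv g) a) := by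
  have hderiv : deriv (fun x => g x ^ (k + 1)) =ᶠ[𝓝 a]
      fun x => (k + 1) * (g x ^ k * deriv g x) := by
    filter_upwards [hg.eventually_analyticAt] with x hx
    rw [(hx.differentiableAt.hasDerivAt.fun_pow (k + 1)).deriv]
    push_cast
    ring
  rw [hderiv.deriv_eq, (((hg.differentiableAt.hasDerivAt.fun_pow k).fun_mul
    hg.deriv.differentiableAt.hasDerivAt).const_mul ((k : 𝕜) + 1)).deriv]
  ring

theorem chebyshevOp_pow_succ [CharZero 𝕜] (hg : AnalyticAt 𝕜 g a) (hg' : deriv g a ≠ 0)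
    (hode : ∀ᶠ x in 𝓝 a, (1 - x ^ 2) * deriv g x ^ 2 = 4 * g x) (k : ℕ) :
    chebyshevOp (fun x => g x ^ (k + 1)) =ᶠ[𝓝 a] fun x => (2 * k + 2) * (2 * k + 1) * g x ^ k := by
  filter_upwards [hode, chebyshevOp_eq_two hg hg' hode, hg.eventually_analyticAt]
    with x hode hcheb hgx
  have hpow : (k : 𝕜) * g x ^ (k - 1) * g x = k * g x ^ k := by
    cases k with
    | zero => simp
    | succ k => simp [pow_succ, mul_assoc]
  rw [chebyshevOp] at hcheb
  rw [chebyshevOp, deriv_deriv_pow_succ hgx,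
    (hgx.differentiableAt.hasDerivAt.fun_pow (k + 1)).deriv, Nat.add_sub_cancel]
  push_cast
  linear_combination ((k : 𝕜) + 1) * k * g x ^ (k - 1) * hode + (k + 1) * g x ^ k * hcheb
    + 4 * (k + 1) * hpow

theorem iteratedDeriv_pow_one [CharZero 𝕜] (hg : AnalyticAt 𝕜 g 1) (hg' : deriv g 1 ≠ 0)
    (hode : ∀ᶠ x in 𝓝 1, (1 - x ^ 2) * deriv g x ^ 2 = 4 * g x) (k n : ℕ) :
    iteratedDeriv n (fun x => g x ^ k) 1 =
      (-1) ^ k * ((2 * k)! / (2 * n - 1)‼) * (centralFactorialPoly 𝕜 n).coeff k := by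
  induction n generalizing k with
  | zero =>
    have hg1 : g 1 = 0 := by simpa using hode.self_of_nhds.symm
    cases k <;> simp [centralFactorialPoly_zero, hg1, coeff_one]
  | succ n ih =>
    cases k with
    | zero => simp [coeff_zero_centralFactorialPoly_succ, iteratedDeriv_const]
    | succ k =>
      have recursion := iteratedDeriv_succ_one_of_chebyshevOp (hg.fun_pow (k + 1)) n
      rw [(chebyshevOp_pow_succ hg hg' hode k).iteratedDeriv_eq n, iteratedDeriv_const_mul_field,
        ih, ih] at recursion
      have hfactorial : ((2 * (k + 1))! : 𝕜) = (2 * k + 2) * (2 * k + 1) * (2 * k)! := by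
        rw [show 2 * (k + 1) = 2 * k + 1 + 1 by ring, Nat.factorial_succ, Nat.factorial_succ]
        push_cast
        ring
      have hdouble : ((2 * (n + 1) - 1)‼ : 𝕜) = (2 * n + 1) * (2 * n - 1)‼ := by
        exact_mod_cast Nat.doubleFactorial_add_one (2 * n)
      have hodd_ne : (2 * n + 1 : 𝕜) ≠ 0 := mod_cast (2 * n).succ_ne_zero
      have hratio : (2 * n + 1 : 𝕜) * ((2 * (k + 1))! / (2 * (n + 1) - 1)‼) =
          (2 * (k + 1))! / (2 * n - 1)‼ := by
        rw [hdouble, ← mul_div_assoc, mul_div_mul_left _ _ hodd_ne]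
      refine mul_left_cancel₀ hodd_ne (recursion.trans ?_)
      rw [coeff_succ_centralFactorialPoly_succ]
      linear_combination (-1) ^ k * (centralFactorialPoly 𝕜 n).coeff k / (2 * n - 1)‼ * hfactorial
        + (-1) ^ k * ((centralFactorialPoly 𝕜 n).coeff k
          - n ^ 2 * (centralFactorialPoly 𝕜 n).coeff (k + 1)) * hratio

end EikonalEquation

end ChebyshevOperator

namespace HasLeftIteratedDeriv

variable {F : Type*} [NormedAddCommGroup F] [NormedSpace ℝ F] {n : ℕ} {a : ℝ}

theorem of_contDiffAt {f : ℝ → F} (hf : ContDiffAt ℝ n f a) :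
    HasLeftIteratedDeriv n f (iteratedDeriv n f a) a where
  contDiffWithinAt := hf.contDiffWithinAt
  iteratedDerivWithin_eq :=
    iteratedDerivWithin_eq_iteratedDeriv (uniqueDiffOn_Iic a) hf self_mem_Iic
  tendsto_iteratedDeriv := by
    have hcont : ContinuousAt (iteratedDeriv n f) a := by
      rw [iteratedDeriv_eq_equiv_comp]
      exact (LinearIsometryEquiv.continuous _).continuousAt.comp
        (hf.continuousAt_iteratedFDeriv le_rfl)
    exact hcont.tendsto.mono_left nhdsWithin_le_nhds

theorem congr {f f₁ : ℝ → F} {c : F} (h : HasLeftIteratedDeriv n f c a)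
    (hf : f₁ =ᶠ[𝓝[≤] a] f) : HasLeftIteratedDeriv n f₁ c a where
  contDiffWithinAt := h.contDiffWithinAt.congr_of_eventuallyEq_of_mem hf self_mem_Iic
  iteratedDerivWithin_eq :=
    (hf.iteratedDerivWithin_eq (hf.self_of_nhdsWithin self_mem_Iic)).trans h.iteratedDerivWithin_eq
  tendsto_iteratedDeriv := by
    refine h.tendsto_iteratedDeriv.congr' ?_
    filter_upwards [eventually_eventually_nhdsWithin.2
      (hf.filter_mono (nhdsWithin_mono a Iio_subset_Iic_self)), self_mem_nhdsWithin] with x hx hxa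
    rw [isOpen_Iio.nhdsWithin_eq hxa] at hx
    exact (EventuallyEq.iteratedDeriv_eq n hx).symm

theorem smul_const {f : ℝ → ℝ} {c : ℝ} (h : HasLeftIteratedDeriv n f c a) (v : F) :
    HasLeftIteratedDeriv n (fun x => f x • v) (c • v) a where
  contDiffWithinAt := h.contDiffWithinAt.smul contDiffWithinAt_const
  iteratedDerivWithin_eq := by
    rw [iteratedDerivWithin_smul_const self_mem_Iic (uniqueDiffOn_Iic a) h.contDiffWithinAt,
      h.iteratedDerivWithin_eq]
  tendsto_iteratedDeriv := by
    refine (h.tendsto_iteratedDeriv.smul_const v).congr' ?_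
    have hcont := h.contDiffWithinAt.eventually (by simp)
    rw [insert_eq_of_mem self_mem_Iic] at hcont
    filter_upwards [hcont.filter_mono (nhdsWithin_mono a Iio_subset_Iic_self),
      self_mem_nhdsWithin] with x hx hxa
    exact (iteratedDeriv_smul_const (hx.contDiffAt (Iic_mem_nhds hxa)) v).symm

end HasLeftIteratedDeriv

/-- The Taylor coefficients of `s ↦ cos √s` at `0`. -/
noncomputable def cosSqrtCoeff (j : ℕ) : ℝ := (-1) ^ j / (2 * j)!

/-- The entire function equal to `cos √s` for `s ≥ 0`: its power series continues `cos √s` through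
the branch point of the square root. -/
noncomputable def cosSqrt : ℝ → ℝ :=
  FormalMultilinearSeries.ofScalarsSum cosSqrtCoeff

theorem cosSqrt_sq (t : ℝ) : cosSqrt (t ^ 2) = Real.cos t := by
  rw [cosSqrt, FormalMultilinearSeries.ofScalars_sum_eq, ← (Real.hasSum_cos t).tsum_eq]
  refine tsum_congr fun j => ?_
  rw [cosSqrtCoeff, smul_eq_mul, ← pow_mul, div_mul_eq_mul_div]

theorem cosSqrt_zero : cosSqrt 0 = 1 := by
  simpa using cosSqrt_sq 0

theorem hasFPowerSeriesAt_cosSqrt :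
    HasFPowerSeriesAt cosSqrt (FormalMultilinearSeries.ofScalars ℝ cosSqrtCoeff) 0 := by
  have hradius : ((1 : NNReal) : ENNReal) ≤
      (FormalMultilinearSeries.ofScalars ℝ cosSqrtCoeff).radius := by
    refine FormalMultilinearSeries.le_radius_of_bound _ 1 fun j => ?_
    rw [FormalMultilinearSeries.ofScalars_norm, cosSqrtCoeff]
    simp only [norm_div, norm_pow, norm_neg, norm_one, one_pow, NNReal.coe_one, mul_one,
      RCLike.norm_natCast]
    exact div_le_one_of_le₀ (mod_cast Nat.factorial_pos _) (by positivity)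
  exact (FormalMultilinearSeries.hasFPowerSeriesOnBall _
    (zero_lt_one.trans_le hradius)).hasFPowerSeriesAt

theorem deriv_cosSqrt_zero : deriv cosSqrt 0 = -1 / 2 := by
  rw [hasFPowerSeriesAt_cosSqrt.deriv]
  simp [cosSqrtCoeff]

theorem exists_analyticAt_eq_arccos_sq :
    ∃ g : ℝ → ℝ, AnalyticAt ℝ g 1 ∧ deriv g 1 ≠ 0 ∧
      (fun x => Real.arccos x ^ 2) =ᶠ[𝓝[≤] 1] g := by
  have hanalytic : AnalyticAt ℝ cosSqrt 0 := hasFPowerSeriesAt_cosSqrt.analyticAt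
  have hstrict := hanalytic.hasStrictDerivAt
  have hne : deriv cosSqrt 0 ≠ 0 := by norm_num [deriv_cosSqrt_zero]
  refine ⟨hstrict.localInverse _ _ _ hne, cosSqrt_zero ▸ hanalytic.analyticAt_localInverse hne,
    ?_, ?_⟩
  · rw [← cosSqrt_zero, (hstrict.to_localInverse hne).hasDerivAt.deriv]
    exact inv_ne_zero hne
  · have harccos : Tendsto (fun x => Real.arccos x ^ 2) (𝓝[≤] 1) (𝓝 0) :=
      ((Real.continuous_arccos.pow 2).tendsto' 1 0 (by simp)).mono_left nhdsWithin_le_nhds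
    filter_upwards [harccos.eventually (hstrict.eventually_left_inverse hne),
      Icc_mem_nhdsLE (show (-1 : ℝ) < 1 by norm_num)] with x hinverse hx
    rw [cosSqrt_sq, Real.cos_arccos hx.1 hx.2] at hinverse
    exact hinverse.symm

theorem one_sub_sq_mul_deriv_arccos_sq_sq {x : ℝ} (hx : x ∈ Ioo (-1) 1) :
    (1 - x ^ 2) * deriv (fun y => Real.arccos y ^ 2) x ^ 2 = 4 * Real.arccos x ^ 2 := by
  have hpos : 0 < 1 - x ^ 2 := by nlinarith [hx.1, hx.2]
  rw [((Real.hasDerivAt_arccos hx.1.ne' hx.2.ne).fun_pow 2).deriv, mul_pow, neg_sq, div_pow,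
    Real.sq_sqrt hpos.le]
  field_simp
  ring

theorem one_sub_sq_mul_deriv_sq_of_eq_arccos_sq {g : ℝ → ℝ} (hg : AnalyticAt ℝ g 1)
    (hgeq : (fun x => Real.arccos x ^ 2) =ᶠ[𝓝[≤] 1] g) :
    ∀ᶠ x in 𝓝 1, (1 - x ^ 2) * deriv g x ^ 2 = 4 * g x := by
  have hleft : ∀ᶠ x in 𝓝[<] 1, (1 - x ^ 2) * deriv g x ^ 2 = 4 * g x := by
    filter_upwards [eventually_eventually_nhdsWithin.2
        (hgeq.filter_mono (nhdsWithin_mono 1 Iio_subset_Iic_self)),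
      Ioo_mem_nhdsLT (show (-1 : ℝ) < 1 by norm_num)] with x hx hmem
    rw [isOpen_Iio.nhdsWithin_eq hmem.2] at hx
    rw [← EventuallyEq.deriv_eq hx, ← hx.self_of_nhds, one_sub_sq_mul_deriv_arccos_sq_sq hmem]
  have hanalytic : AnalyticAt ℝ (fun x => (1 - x ^ 2) * deriv g x ^ 2) 1 := by
    have := hg.deriv
    fun_prop
  exact (hanalytic.frequently_eq_iff_eventually_eq (analyticAt_const.mul hg)).1
    (hleft.frequently.filter_mono (nhdsLT_le_nhdsNE 1))

theorem hasLeftIteratedDeriv_arccos_pow (k n : ℕ) :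
    HasLeftIteratedDeriv n (fun x => Real.arccos x ^ (2 * k))
      ((-1) ^ k * ((2 * k)! / (2 * n - 1)‼) * (centralFactorialPoly ℝ n).coeff k) 1 := by
  obtain ⟨g, hg, hg', hgeq⟩ := exists_analyticAt_eq_arccos_sq
  rw [← iteratedDeriv_pow_one hg hg' (one_sub_sq_mul_deriv_sq_of_eq_arccos_sq hg hgeq) k n]
  refine (HasLeftIteratedDeriv.of_contDiffAt (hg.fun_pow k).contDiffAt).congr ?_
  exact hgeq.mono fun x hx => (pow_mul _ 2 k).trans (congrArg (· ^ k) hx)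

theorem complexArccosh_eq_log_sqrt (z : ℂ) :
    complexArccosh z = Complex.log (z + Complex.sqrt (z + 1) * Complex.sqrt (z - 1)) := by
  rw [complexArccosh, Complex.sqrt, Complex.sqrt, one_div]

open scoped ComplexOrder in
theorem sqrt_add_one_mul_sqrt_sub_one {x : ℝ} (hx : x ∈ Icc (-1) 1) :
    Complex.sqrt (x + 1) * Complex.sqrt (x - 1) = √(1 - x ^ 2) * Complex.I := by
  have hplus : 0 ≤ 1 + x := by linarith [hx.1]
  have hminus : 0 ≤ 1 - x := by linarith [hx.2]
  have hplus' : Complex.sqrt (x + 1) = √(1 + x) := by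
    rw [Complex.sqrt_of_nonneg (mod_cast add_comm x 1 ▸ hplus)]
    simp [add_comm]
  have hminus' : Complex.sqrt (x - 1) = Complex.I * √(1 - x) := by
    have hnonneg : (0 : ℂ) ≤ 1 - x := mod_cast hminus
    rw [← neg_sub, Complex.sqrt_neg_of_nonneg hnonneg, Complex.sqrt_of_nonneg hnonneg]
    simp
  rw [hplus', hminus', show 1 - x ^ 2 = (1 + x) * (1 - x) by ring, Real.sqrt_mul hplus]
  push_cast
  ring

theorem complexArccosh_ofReal {x : ℝ} (hx : x ∈ Icc (-1) 1) :
    complexArccosh x = Real.arccos x * Complex.I := by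
  have hexp : (x : ℂ) + √(1 - x ^ 2) * Complex.I = Complex.exp (Real.arccos x * Complex.I) := by
    rw [Complex.exp_mul_I, ← Complex.ofReal_cos, ← Complex.ofReal_sin,
      Real.cos_arccos hx.1 hx.2, Real.sin_arccos]
  rw [complexArccosh_eq_log_sqrt, sqrt_add_one_mul_sqrt_sub_one hx, hexp, Complex.log_exp]
  · simpa using (neg_neg_of_pos Real.pi_pos).trans_le (Real.arccos_nonneg x)
  · simpa using Real.arccos_le_pi x

theorem complexArccosh_ofReal_pow_two_mul {x : ℝ} (hx : x ∈ Icc (-1) 1) (k : ℕ) :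
    complexArccosh x ^ (2 * k) = Real.arccos x ^ (2 * k) • (-1 : ℂ) ^ k := by
  rw [complexArccosh_ofReal hx, mul_pow, pow_mul Complex.I, Complex.I_sq, Complex.real_smul,
    Complex.ofReal_pow]

theorem hasLeftIteratedDeriv_complexArccosh_pow (k n : ℕ) :
    HasLeftIteratedDeriv n (fun x : ℝ => complexArccosh x ^ (2 * k))
      (((2 * k)! / (2 * n - 1)‼ * (centralFactorialPoly ℝ n).coeff k : ℝ) : ℂ) 1 := by
  have hcosh := ((hasLeftIteratedDeriv_arccos_pow k n).smul_const ((-1 : ℂ) ^ k)).congr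
    (f₁ := fun x : ℝ => complexArccosh x ^ (2 * k)) <| by
      filter_upwards [Icc_mem_nhdsLE (show (-1 : ℝ) < 1 by norm_num)] with x hx
        using complexArccosh_ofReal_pow_two_mul hx k
  convert hcosh using 1
  have hsign : ((-1 : ℂ) ^ k) * (-1) ^ k = 1 := by rw [← mul_pow]; simp
  rw [Complex.real_smul]
  push_cast
  linear_combination -((2 * k)! / (2 * n - 1)‼ * (centralFactorialPoly ℝ n).coeff k : ℂ) * hsign

theorem corollary4p4 (k n : ℕ) (hk : 1 ≤ k) (hn : 1 ≤ n) :
    HasLeftIteratedDeriv n (fun x : ℝ => Real.arccos x ^ (2 * k))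
      (if n < k then (0 : ℝ)
        else if n = k then (-1 : ℝ) ^ k * ((2 * k)‼ : ℝ)
        else (-1 : ℝ) ^ k * (((2 * k)! : ℝ) / ((2 * n - 1)‼ : ℝ))
          * stirlingQ (2 * k) (2 * n - 2 * k)) 1
    ∧
    HasLeftIteratedDeriv n (fun x : ℝ => complexArccosh (x : ℂ) ^ (2 * k))
      (((if n < k then (0 : ℝ)
        else if n = k then ((2 * k)‼ : ℝ)
        else (((2 * k)! : ℝ) / ((2 * n - 1)‼ : ℝ))
          * stirlingQ (2 * k) (2 * n - 2 * k)) : ℝ) : ℂ) 1 := by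
  have hvalue := factorial_div_mul_coeff_centralFactorialPoly hk n
  constructor
  · have harccos := hasLeftIteratedDeriv_arccos_pow k n
    rw [mul_assoc, hvalue] at harccos
    convert harccos using 1
    split_ifs <;> ring
  · rw [← hvalue]
    exact hasLeftIteratedDeriv_complexArccosh_pow k n
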